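/- Assume the Generalized Continuum Hypothesis ($2^{\kappa}=\kappa^{+}$ for every infinite cardinal $\kappa$). Let $F\colon \mathbf{Set}\to\mathbf{Set}$ be a functor which either preserves limits of $\omega^{\mathrm{op}}$-chains $\cdots\to X_2\to X_1\to X_0$, or is finitary (that is, preserves filtered colimits). If $F$ has an initial algebra $\mu F$ whose underlying set has cardinality $\lambda$, where $\lambda$ is an uncountable regular cardinal, then $F$ has a terminal coalgebra $\nu F$, and the underlying set of $\nu F$ also has cardinality $\lambda$. -/

import Mathlib

open CategoryTheory CategoryTheory.Limits CategoryTheory.Endofunctor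
open scoped Cardinal

universe u

/-- The Generalized Continuum Hypothesis (for sets in `Type u`): `2 ^ κ` is the successor of `κ`,
for every infinite cardinal `κ`. -/
def GCH : Prop := ∀ κ : Cardinal.{u}, ℵ₀ ≤ κ → (2 : Cardinal.{u}) ^ κ = Order.succ κ

/-- A set functor is finitary if it preserves filtered colimits. -/
def IsFinitary (F : Type u ⥤ Type u) : Prop := PreservesFilteredColimits F

/-- A set functor preserves `ω^op`-limits, i.e. limits of `ω^op`-chains `⋯ ⟶ X₂ ⟶ X₁ ⟶ X₀`. -/
def PreservesOmegaOpLimits (F : Type u ⥤ Type u) : Prop := PreservesLimitsOfShape ℕᵒᵖ F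

/-!
Write `A = μF`. For `#A` regular and uncountable, every map `ℕ → #A` is bounded, and GCH bounds the
number of maps with a given bound, so that `#A ^ ℵ₀ = #A`. Moreover `F A ≅ A`.

* The algebra morphism from `μF` to the fixed point `νF` is injective, whence `#A ≤ #νF`: a maximal
  set `U` of elements on which it is injective, among those contained in the image of `F U`, is a
  subalgebra.
* If `F` preserves the limit of the terminal chain `Fⁿ 1`, that limit is `νF`. Every `Fⁿ 1` embeds
  into `A`, so that `#νF ≤ #A ^ ℵ₀`.
* If every element of `F X` comes from a countable subset of `X`, then every coalgebra is the
  directed union of its countable subcoalgebras, hence `νF` is a quotient of the sum of all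
  countable coalgebras. Up to isomorphism there are at most `#A ^ ℵ₀` of these.
-/

universe v w

/-! ### Cardinal arithmetic -/

section CardinalArithmetic

lemma mk_sigma_le_of_le {c : Cardinal.{u}} (hc : ℵ₀ ≤ c) {J : Type u} (hJ : #J ≤ c)
    {G : J → Type u} (hG : ∀ j, #(G j) ≤ c) : #(Σ j, G j) ≤ c :=
  calc #(Σ j, G j) = Cardinal.sum fun j ↦ #(G j) := Cardinal.mk_sigma _
    _ ≤ Cardinal.sum fun _ : J ↦ c := Cardinal.sum_le_sum _ _ hG
    _ = #J * c := Cardinal.sum_const' _ _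
    _ ≤ c := Cardinal.mul_le_of_le hc hJ le_rfl

lemma mk_iUnion_le_of_le {c : Cardinal.{u}} (hc : ℵ₀ ≤ c) {X J : Type u} (hJ : #J ≤ c)
    {S : J → Set X} (hS : ∀ j, #(S j) ≤ c) : #(⋃ j, S j) ≤ c :=
  (Cardinal.mk_le_of_surjective (Set.sigmaToiUnion_surjective S)).trans
    (mk_sigma_le_of_le hc hJ hS)

lemma exists_forall_lt_of_mk_lt_cof {ι α : Type u} [LinearOrder α] (h : #ι < Order.cof α)
    (f : ι → α) : ∃ a, ∀ i, f i < a := by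
  have not_cofinal : ¬ IsCofinal (Set.range f) := fun hf ↦
    h.not_ge ((Order.cof_le hf).trans Cardinal.mk_range_le)
  simpa only [not_isCofinal_iff, Set.forall_mem_range] using not_cofinal

theorem power_le_of_lt_cof {c κ : Cardinal.{u}} (hc : ℵ₀ ≤ c) (hκ : κ < c.ord.cof)
    (h : ∀ d < c, d ^ κ ≤ c) : c ^ κ ≤ c := by
  induction κ using Cardinal.inductionOn with | mk K
  let α := c.ord.ToType
  have mk_α : #α = c := Cardinal.mk_ord_toType c
  let below (a : α) : Set (K → α) := {f | ∀ k, f k < a}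
  have iUnion_below : ⋃ a, below a = Set.univ := Set.eq_univ_of_forall fun f ↦
    Set.mem_iUnion.2 (exists_forall_lt_of_mk_lt_cof (hκ.trans_eq (Ordinal.cof_toType _).symm) f)
  have mk_below_le (a : α) : #(below a) ≤ c := by
    have restrict_injective : Function.Injective
        fun (f : below a) k ↦ (⟨f.1 k, f.2 k⟩ : Set.Iio a) := fun f g e ↦
      Subtype.ext (funext fun k ↦ congrArg Subtype.val (congrFun e k))
    have mk_Iio_lt : #(Set.Iio a) < c :=
      (Cardinal.mk_Iio_lt a (by simp [α])).trans_eq mk_α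
    exact (Cardinal.mk_le_of_injective restrict_injective).trans (h _ mk_Iio_lt)
  calc c ^ #K = #(⋃ a, below a) := by rw [iUnion_below, Cardinal.mk_univ, ← mk_α]; rfl
    _ ≤ c := mk_iUnion_le_of_le hc mk_α.le mk_below_le

lemma GCH.power_le_of_lt_of_lt (gch : GCH.{u}) {c d κ : Cardinal.{u}} (hc : ℵ₀ ≤ c) (hd : d < c)
    (hκ : κ < c) : d ^ κ ≤ c := by
  obtain h | h := lt_or_ge (max d κ) ℵ₀
  · exact (Cardinal.power_lt_aleph0 (max_lt_iff.1 h).1 (max_lt_iff.1 h).2).le.trans hc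
  · calc d ^ κ ≤ max d κ ^ κ := Cardinal.power_le_power_right (le_max_left _ _)
      _ ≤ max d κ ^ max d κ :=
        Cardinal.power_le_power_left (Cardinal.aleph0_pos.trans_le h).ne' (le_max_right _ _)
      _ = Order.succ (max d κ) := by rw [Cardinal.power_self_eq h, gch _ h]
      _ ≤ c := Order.succ_le_of_lt (max_lt hd hκ)

theorem GCH.power_le_of_isRegular (gch : GCH.{u}) {c κ : Cardinal.{u}} (hc : c.IsRegular)
    (hκ : κ < c) : c ^ κ ≤ c :=
  power_le_of_lt_cof hc.aleph0_le (hκ.trans_eq hc.cof_ord.symm) fun _ hd ↦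
    gch.power_le_of_lt_of_lt hc.aleph0_le hd hκ

end CardinalArithmetic

/-! ### Set functors -/

section SetFunctor

/-- The inclusion of a subset, as a morphism in the category of types. -/
abbrev subtypeHom {X : Type u} (S : Set X) : (S : Type u) ⟶ X := ↾Subtype.val

lemma map_injective_of_injective (F : Type u ⥤ Type v) {X Y : Type u} [Nonempty X] {f : X ⟶ Y}
    (hf : Function.Injective f) : Function.Injective (F.map f) := by
  have split : f ≫ ↾(Function.invFun f) = 𝟙 X := by
    ext x
    exact Function.leftInverse_invFun hf x
  refine Function.LeftInverse.injective (g := F.map (↾(Function.invFun f))) fun x ↦ ?_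
  rw [← F.map_comp_apply, split, F.map_id_apply]

lemma mk_obj_le_mk_obj (F : Type u ⥤ Type v) {X Y : Type u} [Nonempty X] (h : #X ≤ #Y) :
    #(F.obj X) ≤ #(F.obj Y) := by
  obtain ⟨f⟩ := h
  exact Cardinal.mk_le_of_injective (map_injective_of_injective F (f := ↾f) f.injective)

lemma range_map_subtypeHom_mono (F : Type u ⥤ Type v) {X : Type u} :
    Monotone fun S : Set X ↦ Set.range (F.map (subtypeHom S)) := by
  rintro S T hST _ ⟨w, rfl⟩
  exact ⟨F.map (↾(Set.inclusion hST)) w, by rw [← F.map_comp_apply]; rfl⟩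

theorem mk_pt_le_power_of_isLimit {J : Type w} [Category.{v} J] {D : J ⥤ Type u} {s : Cone D}
    (hs : IsLimit s) {c : Cardinal.{u}} (hD : ∀ j, #(D.obj j) ≤ c) :
    Cardinal.lift.{w} #s.pt ≤ Cardinal.lift.{w} c ^ Cardinal.lift.{u} #J := by
  have proj_injective : Function.Injective fun (x : s.pt) j ↦ s.π.app j x := fun x y e ↦
    (Types.isLimitEquivSections hs).injective (Subtype.ext e)
  calc Cardinal.lift.{w} #s.pt = Cardinal.lift.{max u w} #s.pt :=
      congrFun Cardinal.lift_umax.{u, w}.symm _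
    _ ≤ Cardinal.lift.{u} #(∀ j, D.obj j) :=
      Cardinal.lift_mk_le_lift_mk_of_injective proj_injective
    _ = Cardinal.prod fun j ↦ #(D.obj j) := by simp
    _ ≤ Cardinal.prod fun _ : J ↦ c := Cardinal.prod_le_prod _ _ hD
    _ = Cardinal.lift.{w} c ^ Cardinal.lift.{u} #J := Cardinal.prod_const _ _

end SetFunctor

/-! ### Morphisms from an initial algebra -/

section InitialAlgebra

variable {F : Type u ⥤ Type u} {A T : Algebra F}

/-- The set of elements of an algebra which are obtained by applying the structure map to elements
supported by `U`. A set is a subalgebra if and only if it contains its image under this operator. -/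
def algebraStep (A : Algebra F) (U : Set A.a) : Set A.a :=
  A.str '' Set.range (F.map (subtypeHom U))

lemma algebraStep_mono (A : Algebra F) : Monotone (algebraStep A) := fun _ _ h ↦
  Set.image_mono (range_map_subtypeHom_mono F h)

theorem eq_univ_of_algebraStep_subset (hA : IsInitial A) {U : Set A.a}
    (hU : algebraStep A U ⊆ U) : U = Set.univ := by
  let S : Algebra F :=
    { a := U
      str := ↾fun w ↦ ⟨A.str (F.map (subtypeHom U) w), hU (Set.mem_image_of_mem _ ⟨w, rfl⟩)⟩ }
  let i : S ⟶ A := { f := subtypeHom U, h := rfl }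
  have section_i : hA.to S ≫ i = 𝟙 A := hA.hom_ext _ _
  refine Set.eq_univ_of_forall fun x ↦ ?_
  have : i.f ((hA.to S).f x) = x := types_congr_hom (congrArg Algebra.Hom.f section_i) x
  exact this ▸ ((hA.to S).f x).2

lemma injOn_algebraStep (hT : Function.Injective T.str) (h : A ⟶ T) {U : Set A.a}
    (hU : Set.InjOn h.f U) : Set.InjOn h.f (algebraStep A U) := by
  rintro _ ⟨_, ⟨w, rfl⟩, rfl⟩ _ ⟨_, ⟨w', rfl⟩, rfl⟩ e
  have : Nonempty A.a := ⟨A.str (F.map (subtypeHom U) w)⟩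
  let r : T.a ⟶ A.a := ↾(Function.invFunOn h.f U)
  have retract : (subtypeHom U ≫ h.f) ≫ r = subtypeHom U := by
    ext x
    exact hU.leftInvOn_invFunOn x.2
  have h_str (z : F.obj A.a) : h.f (A.str z) = T.str (F.map h.f z) := (types_congr_hom h.h z).symm
  have map_eq : F.map (subtypeHom U ≫ h.f) w = F.map (subtypeHom U ≫ h.f) w' := by
    rw [h_str, h_str] at e
    simpa only [F.map_comp_apply] using hT e
  have map_inclusion (z : F.obj U) :
      F.map (subtypeHom U) z = F.map r (F.map (subtypeHom U ≫ h.f) z) := by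
    rw [← F.map_comp_apply, retract]
  rw [map_inclusion, map_eq, ← map_inclusion]

theorem injective_of_isInitial (hA : IsInitial A) (hT : Function.Injective T.str) (h : A ⟶ T) :
    Function.Injective h.f := by
  obtain ⟨U, ⟨subset_step, injOn⟩, maximal⟩ :
      ∃ U, Maximal (fun U ↦ U ⊆ algebraStep A U ∧ Set.InjOn h.f U) U := by
    refine zorn_subset _ fun c hc hchain ↦ ⟨⋃₀ c, ⟨?_, ?_⟩, fun s ↦ Set.subset_sUnion_of_mem⟩
    · exact Set.sUnion_subset fun s hs ↦
        (hc hs).1.trans (algebraStep_mono A (Set.subset_sUnion_of_mem hs))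
    · rintro x ⟨s, hs, hx⟩ y ⟨t, ht, hy⟩
      obtain h | h := hchain.total hs ht
      · exact (hc ht).2 (h hx) hy
      · exact (hc hs).2 hx (h hy)
  have step_subset : algebraStep A U ⊆ U :=
    maximal ⟨algebraStep_mono A subset_step, injOn_algebraStep hT h injOn⟩ subset_step
  rwa [eq_univ_of_algebraStep_subset hA step_subset, Set.injOn_univ] at injOn

theorem mk_initial_le_mk_terminal (hA : IsInitial A) {T : Coalgebra F} (hT : IsTerminal T) :
    #A.a ≤ #T.V := by
  have := Coalgebra.Terminal.str_isIso hT
  let T' : Algebra F := ⟨T.V, inv T.str⟩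
  exact Cardinal.mk_le_of_injective
    (injective_of_isInitial (T := T') hA (injective_of_mono (inv T.str)) (hA.to T'))

end InitialAlgebra

/-! ### The limit of the terminal chain -/

section OpSequence

variable {C : Type w} [Category.{v} C] {X : ℕ → C} {f : ∀ n, X (n + 1) ⟶ X n}

/-- The `n`-th projection of a cone over a sequence `⋯ ⟶ X 1 ⟶ X 0`. -/
def opSequenceProj (s : Cone (Functor.ofOpSequence f)) (n : ℕ) : s.pt ⟶ X n := s.π.app ⟨n⟩

lemma opSequenceProj_comp (s : Cone (Functor.ofOpSequence f)) (n : ℕ) :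
    opSequenceProj s (n + 1) ≫ f n = opSequenceProj s n := by
  have := s.w (homOfLE (Nat.le_add_right n 1)).op
  rwa [Functor.ofOpSequence_map_homOfLE_succ] at this

/-- The cone over a sequence `⋯ ⟶ X 1 ⟶ X 0` with given projections. -/
def opSequenceCone {Y : C} (p : ∀ n, Y ⟶ X n) (hp : ∀ n, p (n + 1) ≫ f n = p n) :
    Cone (Functor.ofOpSequence f) where
  pt := Y
  π := NatTrans.ofOpSequence p fun n ↦ by
    rw [Functor.ofOpSequence_map_homOfLE_succ]
    exact (Category.id_comp _).trans (hp n).symm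

end OpSequence

section TerminalChain

variable {C : Type w} [Category.{v} C] [HasTerminal C] (F : C ⥤ C)

/-- The objects `Fⁿ 1` of the terminal chain of an endofunctor. -/
noncomputable def terminalChainObj : ℕ → C
  | 0 => ⊤_ C
  | n + 1 => F.obj (terminalChainObj n)

/-- The connecting morphisms `Fⁿ⁺¹ 1 ⟶ Fⁿ 1` of the terminal chain. -/
noncomputable def terminalChainMap : ∀ n, terminalChainObj F (n + 1) ⟶ terminalChainObj F n
  | 0 => terminal.from _
  | n + 1 => F.map (terminalChainMap n)

/-- The terminal chain `⋯ ⟶ F (F 1) ⟶ F 1 ⟶ 1` of an endofunctor. -/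
noncomputable abbrev terminalChain : ℕᵒᵖ ⥤ C := Functor.ofOpSequence (terminalChainMap F)

variable {F}

/-- The cone over the image of the terminal chain under `F`, that is over the terminal chain
without its last member `1`, obtained from a cone over the terminal chain. -/
noncomputable def shiftedCone (s : Cone (terminalChain F)) : Cone (terminalChain F ⋙ F) where
  pt := s.pt
  π := NatTrans.ofOpSequence (fun n ↦ opSequenceProj s (n + 1)) fun n ↦ by
    rw [Functor.comp_map, Functor.ofOpSequence_map_homOfLE_succ]
    exact (Category.id_comp _).trans (opSequenceProj_comp s (n + 1)).symm

/-- The canonical morphisms `V ⟶ Fⁿ 1` from a coalgebra to the members of the terminal chain. -/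
noncomputable def toTerminalChain (V : Coalgebra F) : ∀ n, V.V ⟶ terminalChainObj F n
  | 0 => terminal.from _
  | n + 1 => V.str ≫ F.map (toTerminalChain V n)

lemma toTerminalChain_comp (V : Coalgebra F) (n : ℕ) :
    toTerminalChain V (n + 1) ≫ terminalChainMap F n = toTerminalChain V n := by
  induction n with
  | zero => exact terminal.hom_ext _ _
  | succ n ih =>
    change (V.str ≫ F.map _) ≫ F.map _ = V.str ≫ F.map _
    rw [Category.assoc, ← F.map_comp, ih]

variable {s : Cone (terminalChain F)} (h : IsLimit (F.mapCone s))

/-- The coalgebra structure on the limit of the terminal chain, for a functor which preserves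
this limit. -/
noncomputable def terminalChainCoalgebra : Coalgebra F where
  V := s.pt
  str := h.lift (shiftedCone s)

/-- The projections of the limit of the terminal chain, as morphisms from the carrier of the
coalgebra. -/
noncomputable def terminalChainCoalgebraProj (n : ℕ) :
    (terminalChainCoalgebra h).V ⟶ terminalChainObj F n :=
  opSequenceProj s n

lemma terminalChainCoalgebra_str_comp (n : ℕ) :
    (terminalChainCoalgebra h).str ≫ F.map (terminalChainCoalgebraProj h n) =
      terminalChainCoalgebraProj h (n + 1) :=
  h.fac (shiftedCone s) ⟨n⟩

variable {h}

lemma hom_comp_terminalChainCoalgebraProj {V : Coalgebra F} (m : V ⟶ terminalChainCoalgebra h)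
    (n : ℕ) : m.f ≫ terminalChainCoalgebraProj h n = toTerminalChain V n := by
  induction n with
  | zero => exact terminal.hom_ext _ _
  | succ n ih =>
    change _ = V.str ≫ F.map (toTerminalChain V n)
    rw [← ih, F.map_comp, ← Category.assoc, m.h, Category.assoc, terminalChainCoalgebra_str_comp]
    rfl

/-- The morphism from a coalgebra to the limit of the terminal chain. -/
noncomputable def toTerminalChainCoalgebra (hs : IsLimit s) (h : IsLimit (F.mapCone s))
    (V : Coalgebra F) : V ⟶ terminalChainCoalgebra h where
  f := hs.lift (opSequenceCone (toTerminalChain V) (toTerminalChain_comp V))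
  h := by
    let l : V.V ⟶ (terminalChainCoalgebra h).V :=
      hs.lift (opSequenceCone (toTerminalChain V) (toTerminalChain_comp V))
    have fac (n : ℕ) : l ≫ terminalChainCoalgebraProj h n = toTerminalChain V n := hs.fac _ ⟨n⟩
    refine h.hom_ext fun ⟨n⟩ ↦ ?_
    change (V.str ≫ F.map l) ≫ F.map (terminalChainCoalgebraProj h n) =
      (l ≫ (terminalChainCoalgebra h).str) ≫ F.map (terminalChainCoalgebraProj h n)
    rw [Category.assoc, ← F.map_comp, fac, Category.assoc, terminalChainCoalgebra_str_comp]
    exact (fac (n + 1)).symm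

/-- The limit of the terminal chain is a terminal coalgebra, for a functor which preserves this
limit. -/
noncomputable def isTerminalTerminalChainCoalgebra (hs : IsLimit s) (h : IsLimit (F.mapCone s)) :
    IsTerminal (terminalChainCoalgebra h) :=
  IsTerminal.ofUniqueHom (toTerminalChainCoalgebra hs h) fun _ m ↦
    Coalgebra.Hom.ext <| hs.hom_ext fun ⟨n⟩ ↦ (hom_comp_terminalChainCoalgebraProj m n).trans
      (hom_comp_terminalChainCoalgebraProj (toTerminalChainCoalgebra hs h _) n).symm

end TerminalChain

section TerminalChainCardinality

variable (F : Type u ⥤ Type u)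

lemma nonempty_terminalChainObj (A : Type u) [Nonempty (F.obj A)] (n : ℕ) :
    Nonempty (terminalChainObj F n) := by
  induction n with
  | zero =>
    let e : (⊤_ Type u) ≃ PUnit.{u + 1} := Types.terminalIso.toEquiv
    exact e.nonempty
  | succ n ih =>
    obtain ⟨x⟩ := ih
    let const : A ⟶ terminalChainObj F n := ↾fun _ ↦ x
    exact ‹Nonempty (F.obj A)›.map (F.map const)

variable {A : Type u} [Nonempty (F.obj A)]

lemma mk_terminalChainObj_le (hA : #(F.obj A) ≤ #A) (n : ℕ) : #(terminalChainObj F n) ≤ #A := by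
  induction n with
  | zero =>
    let e : (⊤_ Type u) ≃ PUnit.{u + 1} := Types.terminalIso.toEquiv
    calc #(⊤_ Type u) = 1 := e.cardinal_eq.trans Cardinal.mk_punit
      _ ≤ #(F.obj A) := Cardinal.one_le_iff_ne_zero.2 (Cardinal.mk_ne_zero _)
      _ ≤ #A := hA
  | succ n ih =>
    have := nonempty_terminalChainObj F A n
    exact (mk_obj_le_mk_obj F ih).trans hA

theorem exists_isTerminal_of_preservesLimit_terminalChain [PreservesLimit (terminalChain F) F]
    (hA : #(F.obj A) ≤ #A) (hpow : #A ^ ℵ₀ ≤ #A) :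
    ∃ T : Coalgebra F, Nonempty (IsTerminal T) ∧ #T.V ≤ #A := by
  let hs := limit.isLimit (terminalChain F)
  have mk_op_nat : #ℕᵒᵖ = ℵ₀ := Opposite.equivToOpposite.cardinal_eq.symm.trans Cardinal.mk_nat
  refine ⟨_, ⟨isTerminalTerminalChainCoalgebra hs (isLimitOfPreserves F hs)⟩, ?_⟩
  have := mk_pt_le_power_of_isLimit hs fun n ↦ mk_terminalChainObj_le F hA n.unop
  exact (by simpa [mk_op_nat] using this : #(limit (terminalChain F)) ≤ #A ^ ℵ₀).trans hpow

end TerminalChainCardinality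

/-! ### Colimits of families of coalgebras -/

section CoalgebraFamily

variable {F : Type u ⥤ Type u} {I : Type u} {W : I → Coalgebra F}

/-- A family of coalgebras is generating if every coalgebra is covered by morphisms from members of
the family, and any two such morphisms factorize through a subcoalgebra in the family. -/
structure IsGenerating (W : I → Coalgebra F) : Prop where
  cover (V : Coalgebra F) (v : V.V) : ∃ (i : I) (f : W i ⟶ V), v ∈ Set.range f.f
  amalgamate {V : Coalgebra F} {i j : I} (f : W i ⟶ V) (g : W j ⟶ V) :
    ∃ (k : I) (m : W k ⟶ V) (f' : W i ⟶ W k) (g' : W j ⟶ W k),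
      Function.Injective m.f ∧ f' ≫ m = f ∧ g' ≫ m = g

variable (W) in
/-- The relation which identifies each element of a member of a family of coalgebras with its images
under the coalgebra morphisms to other members. -/
def coalgebraFamilyRel (x y : Σ i, (W i).V) : Prop :=
  ∃ f : W x.1 ⟶ W y.1, f.f x.2 = y.2

variable (W) in
/-- The canonical map of a member of a family of coalgebras to the colimit of the family. -/
def coalgebraFamilyι (i : I) : (W i).V ⟶ Quot (coalgebraFamilyRel W) :=
  ↾fun x ↦ Quot.mk _ ⟨i, x⟩

lemma comp_coalgebraFamilyι {i j : I} (f : W i ⟶ W j) :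
    f.f ≫ coalgebraFamilyι W j = coalgebraFamilyι W i := by
  ext x
  exact (Quot.sound ⟨f, rfl⟩).symm

variable (W) in
/-- The colimit of the full subcategory of coalgebras on the members of a family. -/
def coalgebraFamilyColimit : Coalgebra F where
  V := Quot (coalgebraFamilyRel W)
  str := ↾(Quot.lift (fun x ↦ F.map (coalgebraFamilyι W x.1) ((W x.1).str x.2)) (by
    rintro ⟨i, x⟩ ⟨j, y⟩ ⟨f : W i ⟶ W j, rfl : f.f x = y⟩
    have f_str : (W j).str (f.f x) = F.map f.f ((W i).str x) := (types_congr_hom f.h x).symm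
    dsimp only
    rw [f_str, ← F.map_comp_apply, comp_coalgebraFamilyι]))

variable (W) in
/-- The canonical morphism of a member of a family of coalgebras to the colimit of the family. -/
def coalgebraFamilyHom (i : I) : W i ⟶ coalgebraFamilyColimit W where
  f := coalgebraFamilyι W i
  h := rfl

lemma exists_coalgebraFamilyHom_apply_eq (z : (coalgebraFamilyColimit W).V) :
    ∃ i x, (coalgebraFamilyHom W i).f x = z := by
  obtain ⟨⟨i, x⟩, rfl⟩ := Quot.exists_rep z
  exact ⟨i, x, rfl⟩

namespace IsGenerating

lemma coalgebraFamilyHom_apply_eq (hW : IsGenerating W) {V : Coalgebra F} {i j : I}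
    (f : W i ⟶ V) (g : W j ⟶ V) {x : (W i).V} {y : (W j).V} (h : f.f x = g.f y) :
    (coalgebraFamilyHom W i).f x = (coalgebraFamilyHom W j).f y := by
  obtain ⟨k, m, f', g', m_injective, rfl, rfl⟩ := hW.amalgamate f g
  have f'_x_eq : f'.f x = g'.f y := m_injective h
  calc coalgebraFamilyι W i x
      = coalgebraFamilyι W k (f'.f x) := (types_congr_hom (comp_coalgebraFamilyι f') x).symm
    _ = coalgebraFamilyι W k (g'.f y) := by rw [f'_x_eq]
    _ = coalgebraFamilyι W j y := types_congr_hom (comp_coalgebraFamilyι g') y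

lemma eq_coalgebraFamilyHom (hW : IsGenerating W) {i : I} (f : W i ⟶ coalgebraFamilyColimit W) :
    f = coalgebraFamilyHom W i := by
  ext x
  obtain ⟨j, y, hy⟩ := exists_coalgebraFamilyHom_apply_eq (f.f x)
  exact hy.symm.trans (hW.coalgebraFamilyHom_apply_eq f _ hy.symm).symm

lemma hom_ext (hW : IsGenerating W) {V U : Coalgebra F} {a b : V ⟶ U}
    (h : ∀ (i : I) (f : W i ⟶ V), f ≫ a = f ≫ b) : a = b := by
  ext v
  obtain ⟨i, f, x, rfl⟩ := hW.cover V v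
  exact types_congr_hom (congrArg Coalgebra.Hom.f (h i f)) x

lemma nonempty_hom_coalgebraFamilyColimit (hW : IsGenerating W) (V : Coalgebra F) :
    Nonempty (V ⟶ coalgebraFamilyColimit W) := by
  choose i f x hx using hW.cover V
  let b : V.V ⟶ (coalgebraFamilyColimit W).V := ↾fun v ↦ (coalgebraFamilyHom W (i v)).f (x v)
  have comp_b {j : I} (g : W j ⟶ V) : g.f ≫ b = (coalgebraFamilyHom W j).f := by
    ext y
    exact hW.coalgebraFamilyHom_apply_eq (f (g.f y)) g (hx (g.f y))
  refine ⟨⟨b, ?_⟩⟩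
  ext v
  obtain ⟨j, g, y, rfl⟩ := hW.cover V v
  have : g.f ≫ V.str ≫ F.map b = g.f ≫ b ≫ (coalgebraFamilyColimit W).str := by
    rw [← Category.assoc, ← g.h, Category.assoc, ← F.map_comp, comp_b, ← Category.assoc, comp_b,
      (coalgebraFamilyHom W j).h]
  exact types_congr_hom this y

theorem nonempty_isTerminal_coalgebraFamilyColimit (hW : IsGenerating W) :
    Nonempty (IsTerminal (coalgebraFamilyColimit W)) :=
  ⟨IsTerminal.ofUniqueHom (fun V ↦ (hW.nonempty_hom_coalgebraFamilyColimit V).some) fun _ _ ↦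
    hW.hom_ext fun _ _ ↦ (hW.eq_coalgebraFamilyHom _).trans (hW.eq_coalgebraFamilyHom _).symm⟩

end IsGenerating

end CoalgebraFamily

/-! ### Bounded functors -/

section BoundedFunctor

/-- A set functor `F` is `κ`-bounded if every element of every `F X` is supported by a subset of `X`
of cardinality at most `κ`. -/
def IsBoundedFunctor (F : Type u ⥤ Type v) (κ : Cardinal.{u}) : Prop :=
  ∀ ⦃X : Type u⦄ (x : F.obj X), ∃ S : Set X, #S ≤ κ ∧ x ∈ Set.range (F.map (subtypeHom S))

theorem IsFinitary.isBoundedFunctor {F : Type u ⥤ Type u} (hF : IsFinitary F) :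
    IsBoundedFunctor F ℵ₀ := fun X x ↦ by
  classical
  have : PreservesFilteredColimits F := hF
  let D : Finset X ⥤ Type u :=
    { obj := fun S ↦ S
      map := fun f ↦ ↾fun x ↦ ⟨x.1, leOfHom f x.2⟩ }
  let t : Cocone D :=
    { pt := X
      ι := { app := fun S ↦ ↾Subtype.val } }
  have ht : IsColimit t := Types.FilteredColimit.isColimitOf' D t
    (fun x ↦ ⟨{x}, ⟨x, Finset.mem_singleton_self x⟩, rfl⟩)
    (fun S _ _ h ↦ ⟨S, 𝟙 S, congr_arg (D.map (𝟙 S)) (Subtype.ext h)⟩)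
  obtain ⟨S, y, hy⟩ := Types.jointly_surjective_of_isColimit (isColimitOfPreserves F ht) x
  exact ⟨S, S.countable_toSet.le_aleph0, y, hy⟩

lemma exists_superset_forall_subset {κ : Cardinal.{u}} (hκ : ℵ₀ ≤ κ) {X : Type u}
    (supp : X → Set X) (hsupp : ∀ x, #(supp x) ≤ κ) {B : Set X} (hB : #B ≤ κ) :
    ∃ C : Set X, #C ≤ κ ∧ B ⊆ C ∧ ∀ x ∈ C, supp x ⊆ C := by
  let next (S : Set X) : Set X := ⋃ x : S, supp x
  let stage (n : ULift.{u} ℕ) : Set X := next^[n.down] B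
  have mk_stage_le (n : ℕ) : #(stage ⟨n⟩) ≤ κ := by
    induction n with
    | zero => exact hB
    | succ n ih =>
      simp only [stage, Function.iterate_succ_apply']
      exact mk_iUnion_le_of_le hκ ih fun x ↦ hsupp x
  refine ⟨⋃ n, stage n, mk_iUnion_le_of_le hκ (by simpa using hκ) fun n ↦ mk_stage_le n.down,
    Set.subset_iUnion stage ⟨0⟩, fun x hx ↦ ?_⟩
  obtain ⟨⟨n⟩, hn⟩ := Set.mem_iUnion.1 hx
  refine Set.Subset.trans ?_ (Set.subset_iUnion stage ⟨n + 1⟩)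
  simp only [stage, Function.iterate_succ_apply']
  exact Set.subset_iUnion (fun x : next^[n] B ↦ supp x) ⟨x, hn⟩

variable {F : Type u ⥤ Type u}

lemma IsBoundedFunctor.exists_subcoalgebra {κ : Cardinal.{u}} (hF : IsBoundedFunctor F κ)
    (hκ : ℵ₀ ≤ κ) (V : Coalgebra F) {B : Set V.V} (hB : #B ≤ κ) :
    ∃ (U : Coalgebra F) (m : U ⟶ V), #U.V ≤ κ ∧ Function.Injective m.f ∧ B ⊆ Set.range m.f := by
  choose supp mk_supp_le mem_range using fun v ↦ hF (V.str v)
  obtain ⟨C, mk_C_le, hBC, supp_subset⟩ := exists_superset_forall_subset hκ supp mk_supp_le hB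
  choose str hstr using fun c : C ↦
    range_map_subtypeHom_mono F (supp_subset c c.2) (mem_range c)
  let m : (⟨C, ↾str⟩ : Coalgebra F) ⟶ V := { f := subtypeHom C, h := by ext c; exact hstr c }
  exact ⟨_, m, mk_C_le, Subtype.val_injective, hBC.trans_eq Subtype.range_val.symm⟩

lemma exists_comp_eq_of_range_subset {U V W : Coalgebra F} {m : U ⟶ V}
    (hm : Function.Injective m.f) (f : W ⟶ V) (h : Set.range f.f ⊆ Set.range m.f) :
    ∃ f' : W ⟶ U, f' ≫ m = f := by
  choose g hg using fun w ↦ h ⟨w, rfl⟩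
  have g_comp_m : (↾g) ≫ m.f = f.f := by
    ext w
    exact hg w
  have g_hom : (W.str ≫ F.map (↾g)) ≫ F.map m.f = ((↾g) ≫ U.str) ≫ F.map m.f := by
    rw [Category.assoc, ← F.map_comp, g_comp_m, Category.assoc, m.h, ← Category.assoc, g_comp_m,
      f.h]
  refine ⟨⟨↾g, ?_⟩, Coalgebra.Hom.ext g_comp_m⟩
  ext w
  have : Nonempty U.V := ⟨g w⟩
  exact map_injective_of_injective F hm (types_congr_hom g_hom w)

variable {K : Type u}

variable (F K) in
/-- The coalgebra structures on subsets of `K`. They index a set of representatives of the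
isomorphism classes of coalgebras of cardinality at most `#K`. -/
abbrev SubsetCoalgebra : Type u := Σ S : Set K, S → F.obj S

/-- The coalgebra given by a coalgebra structure on a subset of `K`. -/
def SubsetCoalgebra.toCoalgebra (i : SubsetCoalgebra F K) : Coalgebra F where
  V := i.1
  str := ↾i.2

lemma exists_subsetCoalgebra_iso {U : Coalgebra F} (hU : #U.V ≤ #K) :
    ∃ i : SubsetCoalgebra F K, Nonempty (i.toCoalgebra ≅ U) := by
  obtain ⟨e⟩ := hU
  let ε : (Set.range e : Type u) ≅ U.V := (Equiv.ofInjective e e.injective).symm.toIso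
  refine ⟨⟨Set.range e, ε.hom ≫ U.str ≫ F.map ε.inv⟩, ⟨Coalgebra.isoMk ε ?_⟩⟩
  change (ε.hom ≫ U.str ≫ F.map ε.inv) ≫ F.map ε.hom = ε.hom ≫ U.str
  simp only [Category.assoc, ← F.map_comp, Iso.inv_hom_id, F.map_id, Category.comp_id]

lemma IsBoundedFunctor.exists_subsetCoalgebra (hF : IsBoundedFunctor F #K) (hK : ℵ₀ ≤ #K)
    (V : Coalgebra F) {B : Set V.V} (hB : #B ≤ #K) :
    ∃ (i : SubsetCoalgebra F K) (m : i.toCoalgebra ⟶ V),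
      Function.Injective m.f ∧ B ⊆ Set.range m.f := by
  obtain ⟨U, m, mk_U_le, m_injective, hBm⟩ := hF.exists_subcoalgebra hK V hB
  obtain ⟨i, ⟨e⟩⟩ := exists_subsetCoalgebra_iso mk_U_le
  have e_bijective : Function.Bijective e.hom.f :=
    ((Coalgebra.forget F).mapIso e).toEquiv.bijective
  refine ⟨i, e.hom ≫ m, m_injective.comp e_bijective.injective, hBm.trans_eq ?_⟩
  exact (e_bijective.surjective.range_comp m.f).symm

theorem IsBoundedFunctor.isGenerating (hF : IsBoundedFunctor F #K) (hK : ℵ₀ ≤ #K) :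
    IsGenerating fun i : SubsetCoalgebra F K ↦ i.toCoalgebra where
  cover V v := by
    have mk_singleton_le : #({v} : Set V.V) ≤ #K := by
      simpa using Cardinal.one_le_aleph0.trans hK
    obtain ⟨i, m, -, hm⟩ := hF.exists_subsetCoalgebra hK V mk_singleton_le
    exact ⟨i, m, hm rfl⟩
  amalgamate {V} i j f g := by
    have mk_range_le (l : SubsetCoalgebra F K) (a : l.toCoalgebra ⟶ V) : #(Set.range a.f) ≤ #K :=
      Cardinal.mk_range_le.trans (Cardinal.mk_set_le l.1)
    have mk_union_le : #(Set.range f.f ∪ Set.range g.f : Set V.V) ≤ #K :=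
      (Cardinal.mk_union_le _ _).trans
        (Cardinal.add_le_of_le hK (mk_range_le i f) (mk_range_le j g))
    obtain ⟨k, m, m_injective, hm⟩ := hF.exists_subsetCoalgebra hK V mk_union_le
    obtain ⟨f', hf'⟩ := exists_comp_eq_of_range_subset m_injective f
      (Set.subset_union_left.trans hm)
    obtain ⟨g', hg'⟩ := exists_comp_eq_of_range_subset m_injective g
      (Set.subset_union_right.trans hm)
    exact ⟨k, m, f', g', m_injective, hf', hg'⟩

variable {A : Type u}

lemma mk_subsetCoalgebra_le (hK : ℵ₀ ≤ #K) (hKA : #K ≤ #A) (hA : #(F.obj A) ≤ #A)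
    (hpow : #A ^ #K ≤ #A) : #(SubsetCoalgebra F K) ≤ #A := by
  have infinite : ℵ₀ ≤ #A := hK.trans hKA
  have mk_A_ne_zero : #A ≠ 0 := (Cardinal.aleph0_pos.trans_le infinite).ne'
  have mk_set_le : #(Set K) ≤ #A :=
    calc #(Set K) = 2 ^ #K := Cardinal.mk_set
      _ ≤ #A ^ #K := Cardinal.power_le_power_right (Cardinal.ofNat_le_aleph0.trans infinite)
      _ ≤ #A := hpow
  refine mk_sigma_le_of_le infinite mk_set_le fun S ↦ ?_
  obtain hS | hS := isEmpty_or_nonempty S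
  · calc #(S → F.obj S) = 1 := Cardinal.mk_eq_one _
      _ ≤ #A := Cardinal.one_le_iff_ne_zero.2 mk_A_ne_zero
  · have mk_obj_le : #(F.obj S) ≤ #A :=
      (mk_obj_le_mk_obj F ((Cardinal.mk_set_le S).trans hKA)).trans hA
    calc #(S → F.obj S) = #(F.obj S) ^ #S := (Cardinal.power_def _ _).symm
      _ ≤ #A ^ #S := Cardinal.power_le_power_right mk_obj_le
      _ ≤ #A ^ #K := Cardinal.power_le_power_left mk_A_ne_zero (Cardinal.mk_set_le S)
      _ ≤ #A := hpow

theorem IsBoundedFunctor.exists_isTerminal (hF : IsBoundedFunctor F #K) (hK : ℵ₀ ≤ #K)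
    (hKA : #K ≤ #A) (hA : #(F.obj A) ≤ #A) (hpow : #A ^ #K ≤ #A) :
    ∃ T : Coalgebra F, Nonempty (IsTerminal T) ∧ #T.V ≤ #A :=
  ⟨_, (hF.isGenerating hK).nonempty_isTerminal_coalgebraFamilyColimit,
    Cardinal.mk_quot_le.trans <|
      mk_sigma_le_of_le (hK.trans hKA) (mk_subsetCoalgebra_le hK hKA hA hpow) fun i ↦
        (Cardinal.mk_set_le i.1).trans hKA⟩

end BoundedFunctor

theorem corollaryC_general (F : Type u ⥤ Type u) {κ : Cardinal.{u}} (hκ : ℵ₀ ≤ κ)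
    (hF : PreservesLimit (terminalChain F) F ∨ IsBoundedFunctor F κ)
    (μF : Algebra F) (hμ : IsInitial μF) (hone : 1 < #μF.a)
    (hpow : #μF.a ^ κ ≤ #μF.a) :
    (∃ νF : Coalgebra F, Nonempty (IsTerminal νF)) ∧
      ∀ νF : Coalgebra F, IsTerminal νF → #νF.V = #μF.a := by
  induction κ using Cardinal.inductionOn with | mk K
  have := Algebra.Initial.str_isIso hμ
  let e : F.obj μF.a ≃ μF.a := (asIso μF.str).toEquiv
  have : Nonempty μF.a := Cardinal.mk_ne_zero_iff.1 (zero_lt_one.trans hone).ne'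
  have : Nonempty (F.obj μF.a) := e.nonempty
  have mk_K_le : #K ≤ #μF.a := (Cardinal.cantor' _ hone).le.trans hpow
  have hpow_aleph0 : #μF.a ^ ℵ₀ ≤ #μF.a :=
    (Cardinal.power_le_power_left (Cardinal.mk_ne_zero _) hκ).trans hpow
  obtain ⟨T, ⟨hT⟩, mk_T_le⟩ : ∃ T : Coalgebra F, Nonempty (IsTerminal T) ∧ #T.V ≤ #μF.a := by
    obtain h | h := hF
    · exact exists_isTerminal_of_preservesLimit_terminalChain F e.cardinal_eq.le hpow_aleph0
    · exact h.exists_isTerminal hκ mk_K_le e.cardinal_eq.le hpow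
  refine ⟨⟨T, ⟨hT⟩⟩, fun νF hν ↦ (mk_initial_le_mk_terminal hμ hν).antisymm' ?_⟩
  have i : νF.V ≅ T.V := (Coalgebra.forget F).mapIso (hν.uniqueUpToIso hT)
  exact i.toEquiv.cardinal_eq.trans_le mk_T_le

theorem corollaryC (gch : GCH.{u}) (F : Type u ⥤ Type u)
    (hF : PreservesOmegaOpLimits F ∨ IsFinitary F)
    (μF : Algebra F) (hμ : IsInitial μF)
    (huncountable : ℵ₀ < #μF.a) (hregular : Cardinal.IsRegular #μF.a) :
    (∃ νF : Coalgebra F, Nonempty (IsTerminal νF)) ∧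
      ∀ νF : Coalgebra F, IsTerminal νF → #νF.V = #μF.a :=
  corollaryC_general F le_rfl (hF.imp (fun h ↦ h.preservesLimit) IsFinitary.isBoundedFunctor) μF hμ
    (Cardinal.one_lt_aleph0.trans huncountable) (gch.power_le_of_isRegular hregular huncountable)
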